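/- **Lower bound with $\delta=0$, $\sigma=1$.** There is an absolute constant $c>0$ such that for every $\mu>0$ there is $\varepsilon_0=\varepsilon_0(\mu)\in(0,1)$ with the following property. Let $L\ge\mu$, let $\tau\ge 1$ be an integer, and let $\varepsilon_1>0$. Then there exist a dimension $d$, a Polish space $\mathsf Z$, a Markov kernel $Q$ on $\mathsf Z$, a probability measure $\pi$ on $\mathsf Z$ and a function $F:\mathbb R^d\times\mathsf Z\to\mathbb R$, differentiable in $x$ and $\pi$-integrable in $z$, such that $f(x)=\mathbb E_{Z\sim\pi}[F(x,Z)]$ has a minimizer $x^*$ and satisfies: 1. $f$ is differentiable and $\|\nabla f(x)-\nabla f(y)\|\le L\|x-y\|$ for all $x,y\in\mathbb R^d$; 2. $f$ is continuously differentiable and $\frac{\mu}{2}\|x-y\|^2\le f(x)-f(y)-\langle\nabla f(y),x-y\rangle$ for all $x,y\in\mathbb R^d$; 3. $\pi$ is the unique invariant distribution of $Q$, and $\sup_{z,z'}\frac12\|Q^k(z,\cdot)-Q^k(z',\cdot)\|_{\mathsf{TV}}\le(1/4)^{\lfloor k/\tau\rfloor}$ for every $k\in\mathbb N$; 4. $\mathbb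 E_\pi[\nabla F(x,Z)]=\nabla f(x)$ and $\|\nabla F(x,z)-\nabla f(x)\|^2\le\sigma^2+\delta^2\|\nabla f(x)\|^2$ for all $x,z$, with $\sigma=1$ and $\delta=0$; and such that, for every first-order gradient method started at $x^0=0$ and run with the stationary Markov chain $(Z_i)_{i\ge0}$ (kernel $Q$, $Z_0\sim\pi$), for every $\varepsilon\in[\varepsilon_1,\varepsilon_0]$ and every number $N$ of oracle calls, $$\mathbb E\big[\|x^N-x^*\|^2\big]\le\varepsilon\quad\Longrightarrow\quad N\ \ge\ c\,\Big(\tau+\sqrt{L/\mu}\Big)\log\frac1\varepsilon .$$ Here a first-order gradient method makes its $i$-th oracle call ($i=0,1,\dots$) at a point $y^i$, receives $\nabla F(y^i,Z_i)$, and outputs $x^k$ after $k$ calls, where $y^k$ and $x^k$ are random vectors that almost surely lie in $x^0+\operatorname{span}\{\nabla F(y^i,Z_i): i<k\}$; the coefficients of the linear combinations may be arbitrary and random. -/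

import Mathlib

open MeasureTheory ProbabilityTheory
open scoped ENNReal

namespace MarkovOpt

/-- The `k`-step kernel of a Markov kernel is a Markov kernel. -/
instance isMarkovKernel_pow {S : Type*} [MeasurableSpace S] (Q : Kernel S S) [IsMarkovKernel Q]
    (k : ℕ) : IsMarkovKernel (Q ^ k) := by
  induction k with
  | zero => exact inferInstanceAs (IsMarkovKernel (Kernel.id : Kernel S S))
  | succ n ih =>
    rw [Kernel.pow_add]
    have : IsMarkovKernel (Q ^ 1) := by rw [pow_one]; infer_instance
    infer_instance

/-- Total variation norm of the difference of two finite measures: the total mass of the total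
variation of the signed measure `ν₁ - ν₂` (so it lies in `[0, 2]` for probability measures). -/
noncomputable def tvNormSub {S : Type*} [MeasurableSpace S] (ν₁ ν₂ : Measure S)
    [IsFiniteMeasure ν₁] [IsFiniteMeasure ν₂] : ℝ≥0∞ :=
  (ν₁.toSignedMeasure - ν₂.toSignedMeasure).totalVariation Set.univ

/-- Dobrushin coefficient `sup_{z, z'} (1/2) ‖Q(z, ·) - Q(z', ·)‖_TV` of a Markov kernel. -/
noncomputable def dobrushin {S : Type*} [MeasurableSpace S] (Q : Kernel S S)
    [IsMarkovKernel Q] : ℝ≥0∞ :=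
  ⨆ (z : S) (z' : S), (1 / 2) * tvNormSub (Q z) (Q z')

/-- `Z 0, Z 1, …` is a time-homogeneous Markov chain on `(Ω, P)` with kernel `Q` and initial
distribution `ξ`: the law of `Z (n + 1)` given `Z 0, …, Z n` is `Q (Z n)`. -/
structure IsMarkovChain {S Ω : Type*} [MeasurableSpace S] [MeasurableSpace Ω]
    (Q : Kernel S S) (ξ : Measure S) (Z : ℕ → Ω → S) (P : Measure Ω) : Prop where
  measurable : ∀ n, Measurable (Z n)
  initial : P.map (Z 0) = ξ
  markov : ∀ (n : ℕ) (A : Set S), MeasurableSet A →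
    P[(Z (n + 1) ⁻¹' A).indicator (fun _ => (1 : ℝ)) |
        ⨆ j : Fin (n + 1), MeasurableSpace.comap (Z j) inferInstance]
      =ᵐ[P] fun ω => (Q (Z n ω)).real A

/-- The data of a stochastic optimization problem with Markovian noise on `ℝ^d`: a Polish state
space, a Markov kernel `Q` on it, a probability measure `π`, and the noisy function `F(x, z)`.
The assumptions on these data are the predicates below. -/
structure Problem (d : ℕ) where
  State : Type
  [topologicalSpace : TopologicalSpace State]
  [polishSpace : PolishSpace State]
  [measurableSpace : MeasurableSpace State]
  [borelSpace : BorelSpace State]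
  Q : Kernel State State
  [isMarkovKernel : IsMarkovKernel Q]
  π : Measure State
  [isProbabilityMeasure : IsProbabilityMeasure π]
  F : EuclideanSpace ℝ (Fin d) → State → ℝ

attribute [instance] Problem.topologicalSpace Problem.polishSpace Problem.measurableSpace
  Problem.borelSpace Problem.isMarkovKernel Problem.isProbabilityMeasure

namespace Problem

variable {d : ℕ} (I : Problem d)

/-- The objective `f(x) = E_{Z ∼ π} F(x, Z)`. -/
noncomputable def f (x : EuclideanSpace ℝ (Fin d)) : ℝ := ∫ z, I.F x z ∂I.π

/-- The stochastic gradient `∇F(x, z)`, the gradient of `F(·, z)` at `x`. -/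
noncomputable def gradF (x : EuclideanSpace ℝ (Fin d)) (z : I.State) :
    EuclideanSpace ℝ (Fin d) := gradient (fun u => I.F u z) x

/-- The oracle is well defined: `F(·, z)` is differentiable, `F(x, ·)` is `π`-integrable and
`∇F` is jointly measurable. -/
structure OracleWellDefined : Prop where
  differentiable : ∀ z, Differentiable ℝ (fun x => I.F x z)
  integrable : ∀ x, Integrable (I.F x) I.π
  measurable : Measurable (Function.uncurry I.gradF)

/-- `f` is `L`-smooth. -/
structure IsSmooth (L : ℝ) : Prop where
  differentiable : Differentiable ℝ I.f
  lipschitz : ∀ x y, ‖gradient I.f x - gradient I.f y‖ ≤ L * ‖x - y‖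

/-- `f` is `μ`-strongly convex. -/
structure IsStronglyConvex (μ : ℝ) : Prop where
  contDiff : ContDiff ℝ 1 I.f
  bound : ∀ x y, μ / 2 * ‖x - y‖ ^ 2 ≤ I.f x - I.f y - inner ℝ (gradient I.f y) (x - y)

/-- `π` is the unique invariant distribution of `Q`, and `Q` is uniformly geometrically ergodic
with mixing time `τ`. -/
structure IsMixing (τ : ℕ) : Prop where
  invariant : Kernel.Invariant I.Q I.π
  unique : ∀ ν : Measure I.State, IsProbabilityMeasure ν → Kernel.Invariant I.Q ν → ν = I.π
  ergodic : ∀ k : ℕ, dobrushin (I.Q ^ k) ≤ (1 / 4) ^ (k / τ)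

/-- The stochastic gradient is unbiased under `π` and its noise satisfies the growth bound with
constants `σ` and `δ`. -/
structure HasBoundedNoise (σ δ : ℝ) : Prop where
  integrable : ∀ x, Integrable (I.gradF x) I.π
  unbiased : ∀ x, ∫ z, I.gradF x z ∂I.π = gradient I.f x
  bound : ∀ z x, ‖I.gradF x z - gradient I.f x‖ ^ 2 ≤ σ ^ 2 + δ ^ 2 * ‖gradient I.f x‖ ^ 2

/-- A (possibly randomized) first-order gradient method started at `x₀`. The `i`-th oracle call
is made at the point `y i` and is answered by `∇F(y i, Z i)`; `x k` is the output of the method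
after `k` oracle calls, that is, after the calls `0, …, k - 1`. Every query point and every output
lies in `x₀` plus the linear span of the answers received so far. The coefficients are arbitrary:
they may be random and depend in any way on the past (nothing even forbids them to depend on the
future of `Z`, which only enlarges the class of methods). -/
structure IsFirstOrderMethod {Ω : Type*} [MeasurableSpace Ω] (P : Measure Ω)
    (Z : ℕ → Ω → I.State) (x₀ : EuclideanSpace ℝ (Fin d))
    (y x : ℕ → Ω → EuclideanSpace ℝ (Fin d)) : Prop where
  measurable_query : ∀ k, Measurable (y k)
  measurable_output : ∀ k, Measurable (x k)
  query_mem : ∀ k, ∀ᵐ ω ∂P,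
    y k ω - x₀ ∈ Submodule.span ℝ ((fun i => I.gradF (y i ω) (Z i ω)) '' {i | i < k})
  output_mem : ∀ k, ∀ᵐ ω ∂P,
    x k ω - x₀ ∈ Submodule.span ℝ ((fun i => I.gradF (y i ω) (Z i ω)) '' {i | i < k})

end Problem

end MarkovOpt

/-! The instance may depend on `μ`, `L`, `τ` and `ε₁`, so it suffices to force the larger of the two
terms `τ` and `√(L/μ)` by itself; which instance is used depends on whether `√(L/μ) ≤ 2τ`. Both are
quadratics on a two-state chain that keeps its state with probability `p`, where `p ^ τ = 1/4`, and
otherwise resamples a fair coin.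

If mixing dominates, take `μx²/2` with a linear force that is present in only one state. With
probability at least `p ^ N / 2` the chain shows only the other state up to time `N`; all answers
are then zero and a span method is still at the origin, at squared distance `1/(4μ²)` from the
minimizer. Hence `p ^ N / (8μ²) ≤ ε`, and logarithms give the `τ` bound
(`dormantProblem_lower_bound`).

If conditioning dominates, no noise is needed: a finite-dimensional form of Nesterov's tridiagonal
quadratic has minimizer `(1, q, q², …)`, and each call reveals at most one new coordinate, so the
squared error after `N` calls is at least `q ^ (2N)` (`chainProblem_lower_bound`). The dimension
must exceed `N`; as `ε ≥ ε₁`, a dimension of order `√(L/μ) log(1/ε₁)` is enough. -/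

namespace MarkovOpt

open scoped NNReal

/-! ### Refreshing Markov chains: invariance, mixing, probability of staying put -/

section Refresh

variable {S : Type*} [MeasurableSpace S]

/-- The kernel of the chain that keeps its state with probability `p` and otherwise draws a fresh
state from `π`. -/
noncomputable def refreshKernel (p : ℝ≥0) (π : Measure S) : Kernel S S where
  toFun z := p • Measure.dirac z + (1 - p) • π
  measurable' := by
    refine Measure.measurable_of_measurable_coe _ fun s hs => ?_
    simp only [Measure.add_apply, Measure.smul_apply, Measure.dirac_apply' _ hs, ENNReal.smul_def,
      smul_eq_mul]
    exact ((measurable_one.indicator hs).const_mul _).add_const _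

variable {p : ℝ≥0} {π : Measure S}

theorem refreshKernel_apply (z : S) :
    refreshKernel p π z = p • Measure.dirac z + (1 - p) • π := rfl

theorem refreshKernel_apply_apply (z : S) {s : Set S} (hs : MeasurableSet s) :
    refreshKernel p π z s = p * s.indicator 1 z + (1 - p : ℝ≥0) * π s := by
  rw [refreshKernel_apply, Measure.add_apply, Measure.smul_apply, Measure.smul_apply,
    Measure.dirac_apply' _ hs, ENNReal.smul_def, ENNReal.smul_def, smul_eq_mul, smul_eq_mul]

theorem isMarkovKernel_refreshKernel [IsProbabilityMeasure π] (hp : p ≤ 1) :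
    IsMarkovKernel (refreshKernel p π) := by
  refine ⟨fun z => ⟨?_⟩⟩
  rw [refreshKernel_apply_apply z .univ]
  simp only [Set.indicator_univ, Pi.one_apply, mul_one, measure_univ]
  exact_mod_cast add_tsub_cancel_of_le hp

theorem bind_refreshKernel (ν : Measure S) [IsProbabilityMeasure ν] :
    ν.bind (refreshKernel p π) = p • ν + (1 - p) • π := by
  ext s hs
  rw [Measure.bind_apply hs (Kernel.aemeasurable _)]
  simp only [refreshKernel_apply_apply _ hs]
  rw [lintegral_add_right _ measurable_const, lintegral_const_mul _ (measurable_one.indicator hs),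
    lintegral_indicator_one hs, lintegral_const, measure_univ, mul_one, Measure.add_apply,
    Measure.smul_apply, Measure.smul_apply, ENNReal.smul_def, ENNReal.smul_def, smul_eq_mul,
    smul_eq_mul]

theorem invariant_refreshKernel [IsProbabilityMeasure π] (hp : p ≤ 1) :
    Kernel.Invariant (refreshKernel p π) π := by
  rw [Kernel.Invariant, bind_refreshKernel, ← add_smul, add_tsub_cancel_of_le hp, one_smul]

theorem eq_of_invariant_refreshKernel (hp : p < 1) {ν : Measure S}
    [IsProbabilityMeasure ν] (h : Kernel.Invariant (refreshKernel p π) ν) : ν = π := by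
  rw [Kernel.Invariant, bind_refreshKernel] at h
  ext s hs
  have h1 : (p : ℝ≥0∞) * ν s + (1 - p : ℝ≥0) * π s = p * ν s + (1 - p : ℝ≥0) * ν s := by
    rw [← add_mul, ← ENNReal.coe_add, add_tsub_cancel_of_le hp.le, ENNReal.coe_one, one_mul]
    conv_rhs => rw [← h]
    rw [Measure.add_apply, Measure.smul_apply, Measure.smul_apply, ENNReal.smul_def,
      ENNReal.smul_def, smul_eq_mul, smul_eq_mul]
  have h2 := (ENNReal.add_right_inj (by finiteness)).1 h1
  refine ((ENNReal.mul_right_inj ?_ (by finiteness)).1 h2).symm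
  exact_mod_cast (tsub_pos_of_lt hp).ne'

/-- After `k` steps the initial state survives only if no refresh occurred, which has probability `p
^ k`. Mixing thus reduces to a one-step estimate. -/
theorem refreshKernel_pow [IsProbabilityMeasure π] (hp : p ≤ 1) (k : ℕ) :
    refreshKernel p π ^ k = refreshKernel (p ^ k) π := by
  induction k with
  | zero =>
    ext z s hs
    rw [refreshKernel_apply_apply z hs]
    have h : (refreshKernel p π ^ 0) z = Measure.dirac z := Kernel.id_apply z
    rw [h, Measure.dirac_apply' _ hs]
    simp
  | succ k ih =>
    ext z s hs
    have := isMarkovKernel_refreshKernel (π := π) (pow_le_one' hp k)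
    rw [Kernel.pow_succ_apply_eq_lintegral _ _ _ hs, ih]
    simp only [refreshKernel_apply_apply _ hs]
    have hpk : p ^ (k + 1) ≤ 1 := pow_le_one' hp _
    have hmul : p * (1 - p ^ k) + (1 - p) = 1 - p ^ (k + 1) := by
      rw [← NNReal.coe_inj]
      push_cast [NNReal.coe_sub hp, NNReal.coe_sub (pow_le_one' hp k), NNReal.coe_sub hpk]
      ring
    rw [lintegral_add_right _ measurable_const,
      lintegral_const_mul _ (measurable_one.indicator hs), lintegral_indicator_one hs,
      refreshKernel_apply_apply _ hs, ← hmul]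
    simp
    ring

/-- The common part `ρ` cancels, and the two remaining atoms, if distinct, are mutually singular, so
they are themselves the Jordan decomposition of the difference. -/
theorem tvNormSub_smul_dirac_add_le [MeasurableSingletonClass S] (r : ℝ≥0) (ρ : Measure S)
    [IsFiniteMeasure ρ] (z z' : S) :
    tvNormSub (r • Measure.dirac z + ρ) (r • Measure.dirac z' + ρ) ≤ 2 * r := by
  unfold tvNormSub
  rw [Measure.toSignedMeasure_add, Measure.toSignedMeasure_add, add_sub_add_right_eq_sub]
  by_cases hz : z = z'
  · subst hz
    simp [SignedMeasure.totalVariation_zero]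
  · have hsing : (r • Measure.dirac z) ⟂ₘ (r • Measure.dirac z') := by
      refine ⟨{z'}, measurableSet_singleton _, ?_, ?_⟩
      · simp [hz]
      · simp
    let j : JordanDecomposition S :=
      { posPart := r • Measure.dirac z
        negPart := r • Measure.dirac z'
        mutuallySingular := hsing }
    have hj : ((r • Measure.dirac z).toSignedMeasure - (r • Measure.dirac z').toSignedMeasure
        ).toJordanDecomposition = j := SignedMeasure.toJordanDecomposition_eq rfl
    rw [SignedMeasure.totalVariation, hj]
    simp [j, two_mul]

theorem dobrushin_refreshKernel_le [MeasurableSingletonClass S] [IsProbabilityMeasure π]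
    [IsMarkovKernel (refreshKernel p π)] : dobrushin (refreshKernel p π) ≤ p := by
  refine iSup₂_le fun z z' => ?_
  have h : tvNormSub (refreshKernel p π z) (refreshKernel p π z') ≤ 2 * p :=
    tvNormSub_smul_dirac_add_le p ((1 - p) • π) z z'
  calc (1 / 2) * tvNormSub (refreshKernel p π z) (refreshKernel p π z')
      ≤ (1 / 2) * (2 * p) := by gcongr
    _ = p := by
      rw [← mul_assoc, one_div, ENNReal.inv_mul_cancel (by norm_num) (by norm_num), one_mul]

/-- A Markov chain with a refreshing kernel stays in the state `a` during its first `n + 1` steps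
with probability at least `π {a} p ^ n`. -/
theorem IsMarkovChain.le_measure_forall_eq [MeasurableSingletonClass S] [IsProbabilityMeasure π]
    {Ω : Type*} [MeasurableSpace Ω] {P : Measure Ω} [IsProbabilityMeasure P] {Z : ℕ → Ω → S}
    (hZ : IsMarkovChain (refreshKernel p π) π Z P) (a : S) (n : ℕ) :
    π.real {a} * (p : ℝ) ^ n ≤ P.real {ω | ∀ i ≤ n, Z i ω = a} := by
  have hmeas (n : ℕ) : MeasurableSet {ω | ∀ i ≤ n, Z i ω = a} := by
    simp only [Set.ofPred_forall]
    exact .iInter fun i => .iInter fun _ => hZ.measurable i (measurableSet_singleton a)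
  induction n with
  | zero =>
    rw [← hZ.initial, measureReal_def, Measure.map_apply (hZ.measurable 0)
      (measurableSet_singleton a), measureReal_def]
    simp [Set.preimage]
  | succ n ih =>
    have hB : MeasurableSet (Z (n + 1) ⁻¹' {a}) :=
      hZ.measurable _ (measurableSet_singleton a)
    have hint : Integrable ((Z (n + 1) ⁻¹' {a}).indicator fun _ => (1 : ℝ)) P :=
      (integrable_const 1).indicator hB
    have hmle : (⨆ j : Fin (n + 1), MeasurableSpace.comap (Z j) inferInstance)
        ≤ ‹MeasurableSpace Ω› := iSup_le fun j => (hZ.measurable j).comap_le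
    have hA : MeasurableSet[⨆ j : Fin (n + 1), MeasurableSpace.comap (Z j) inferInstance]
        {ω | ∀ i ≤ n, Z i ω = a} := by
      simp only [Set.ofPred_forall]
      refine .iInter fun i => .iInter fun hi => ?_
      exact le_iSup (fun j : Fin (n + 1) => MeasurableSpace.comap (Z j) inferInstance)
          ⟨i, Nat.lt_succ_of_le hi⟩ _ ⟨{a}, measurableSet_singleton a, rfl⟩
    -- Integrating the Markov property over the event of having stayed at `a` so far gives the exact
    -- one-step recursion for its probability.
    have key := setIntegral_condExp hmle hint hA
    rw [setIntegral_congr_ae (g := fun _ => (refreshKernel p π a).real {a}) (hmeas n)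
        ((hZ.markov n {a} (measurableSet_singleton a)).mono fun ω h hω => by
          rw [h]; dsimp only; rw [hω n le_rfl]),
      setIntegral_const, setIntegral_indicator hB, setIntegral_const, smul_eq_mul, smul_eq_mul,
      mul_one] at key
    have hset : {ω | ∀ i ≤ n + 1, Z i ω = a}
        = {ω | ∀ i ≤ n, Z i ω = a} ∩ Z (n + 1) ⁻¹' {a} := by
      ext ω
      simp only [Set.mem_ofPred_eq, Set.mem_inter_iff, Set.mem_preimage, Set.mem_singleton_iff,
        Nat.le_succ_iff]
      exact ⟨fun h => ⟨fun i hi => h i (.inl hi), h _ (.inr rfl)⟩,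
        fun h i hi => hi.elim (h.1 i) fun e => e ▸ h.2⟩
    have hstay : (p : ℝ) ≤ (refreshKernel p π a).real {a} := by
      rw [measureReal_def, refreshKernel_apply_apply a (measurableSet_singleton a)]
      rw [ENNReal.toReal_add (by simp) (by finiteness)]
      simp
      positivity
    rw [hset, ← key, pow_succ, ← mul_assoc]
    gcongr

end Refresh

/-! ### Quadratic functions -/

section Quadratic

variable {E : Type*} [NormedAddCommGroup E] [InnerProductSpace ℝ E]

/-- The quadratic function with Hessian `T` and linear term `-⟨b, ·⟩`. -/
noncomputable def quadratic (T : E →L[ℝ] E) (b x : E) : ℝ :=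
  1 / 2 * inner ℝ (T x) x - inner ℝ b x

theorem hasGradientAt_quadratic [CompleteSpace E] {T : E →L[ℝ] E}
    (hT : T.toLinearMap.IsSymmetric) (b x : E) :
    HasGradientAt (quadratic T b) (T x - b) x := by
  rw [hasGradientAt_iff_hasFDerivAt]
  have h1 := ((hT.hasStrictFDerivAt_reApplyInnerSelf x).hasFDerivAt.const_mul (1 / 2)).sub
    (innerSL ℝ b).hasFDerivAt
  refine h1.congr_fderiv ?_
  ext v
  simp

/-- The Bregman divergence of a quadratic does not see the linear term; strong convexity and
minimality both follow from this. -/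
theorem quadratic_sub_sub {T : E →L[ℝ] E} (hT : T.toLinearMap.IsSymmetric) (b x y : E) :
    quadratic T b x - quadratic T b y - inner ℝ (T y - b) (x - y)
      = 1 / 2 * inner ℝ (T (x - y)) (x - y) := by
  have h : inner ℝ (T x) y = inner ℝ (T y) x := by
    rw [real_inner_comm x (T y)]; exact hT x y
  simp only [quadratic, map_sub, inner_sub_left, inner_sub_right, h]
  ring

end Quadratic

/-- The law of a fair coin. -/
noncomputable def fairCoin : Measure Bool :=
  (2⁻¹ : ℝ≥0) • Measure.dirac false + (2⁻¹ : ℝ≥0) • Measure.dirac true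

instance : IsProbabilityMeasure fairCoin := by
  constructor
  simp [fairCoin, ENNReal.inv_two_add_inv_two]

theorem fairCoin_real_false : fairCoin.real {false} = 1 / 2 := by
  simp [fairCoin, measureReal_def]

theorem integral_fairCoin {G : Type*} [NormedAddCommGroup G] [NormedSpace ℝ G] [CompleteSpace G]
    (g : Bool → G) : ∫ z, g z ∂fairCoin = (1 / 2 : ℝ) • (g false + g true) := by
  rw [fairCoin, integral_add_measure .of_finite .of_finite, integral_smul_nnreal_measure,
    integral_smul_nnreal_measure, integral_dirac, integral_dirac, smul_add]
  simp [NNReal.smul_def]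

/-! ### Verification of the assumptions for quadratics driven by the coin chain -/

section QuadraticProblem

variable {d : ℕ}

/-- A quadratic objective whose linear term is driven by a refreshing chain on two states. -/
noncomputable def quadraticProblem (p : ℝ≥0) (hp : p ≤ 1)
    (T : EuclideanSpace ℝ (Fin d) →L[ℝ] EuclideanSpace ℝ (Fin d))
    (b : Bool → EuclideanSpace ℝ (Fin d)) : Problem d where
  State := Bool
  Q := refreshKernel p fairCoin
  isMarkovKernel := isMarkovKernel_refreshKernel hp
  π := fairCoin
  F x z := quadratic T (b z) x

variable {p : ℝ≥0} {hp : p ≤ 1} {T : EuclideanSpace ℝ (Fin d) →L[ℝ] EuclideanSpace ℝ (Fin d)}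
  {b : Bool → EuclideanSpace ℝ (Fin d)}

theorem quadraticProblem_f :
    (quadraticProblem p hp T b).f = quadratic T ((1 / 2 : ℝ) • (b false + b true)) := by
  funext x
  refine (integral_fairCoin fun z => quadratic T (b z) x).trans ?_
  simp only [quadratic, inner_smul_left, inner_add_left, smul_eq_mul]
  simp
  ring

theorem quadraticProblem_gradF (hT : T.toLinearMap.IsSymmetric)
    (x : EuclideanSpace ℝ (Fin d)) (z : (quadraticProblem p hp T b).State) :
    (quadraticProblem p hp T b).gradF x z = T x - b z :=
  (hasGradientAt_quadratic hT (b z) x).gradient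

theorem quadraticProblem_gradient_f (hT : T.toLinearMap.IsSymmetric)
    (x : EuclideanSpace ℝ (Fin d)) :
    gradient (quadraticProblem p hp T b).f x = T x - (1 / 2 : ℝ) • (b false + b true) := by
  rw [quadraticProblem_f]
  exact (hasGradientAt_quadratic hT _ x).gradient

theorem quadraticProblem_oracleWellDefined (hT : T.toLinearMap.IsSymmetric) :
    (quadraticProblem p hp T b).OracleWellDefined where
  differentiable z x := (hasGradientAt_quadratic hT (b z) x).differentiableAt
  integrable x := Integrable.of_finite (α := Bool) (μ := fairCoin)
  measurable := by
    have h : Function.uncurry (quadraticProblem p hp T b).gradF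
        = fun w : EuclideanSpace ℝ (Fin d) × Bool => T w.1 - b w.2 :=
      funext fun w => quadraticProblem_gradF hT w.1 w.2
    rw [h]
    exact (T.measurable.comp measurable_fst).sub
      ((Measurable.of_discrete (f := b)).comp measurable_snd)

theorem quadraticProblem_isSmooth (hT : T.toLinearMap.IsSymmetric) {L : ℝ}
    (hL : ∀ x, ‖T x‖ ≤ L * ‖x‖) : (quadraticProblem p hp T b).IsSmooth L where
  differentiable := by
    rw [quadraticProblem_f]
    exact fun x => (hasGradientAt_quadratic hT _ x).differentiableAt
  lipschitz x y := by
    rw [quadraticProblem_gradient_f hT, quadraticProblem_gradient_f hT, sub_sub_sub_cancel_right,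
      ← map_sub]
    exact hL _

theorem quadraticProblem_isStronglyConvex (hT : T.toLinearMap.IsSymmetric) {μ : ℝ}
    (hμ : ∀ x, μ * ‖x‖ ^ 2 ≤ inner ℝ (T x) x) :
    (quadraticProblem p hp T b).IsStronglyConvex μ where
  contDiff := by
    rw [quadraticProblem_f]
    exact (contDiff_const.mul (T.contDiff.inner ℝ contDiff_id)).sub
      (contDiff_const.inner ℝ contDiff_id)
  bound x y := by
    rw [quadraticProblem_gradient_f hT, quadraticProblem_f, quadratic_sub_sub hT]
    linarith [hμ (x - y)]

theorem quadraticProblem_isMixing (hp1 : p < 1) {τ : ℕ} (hτ : p ^ τ ≤ 1 / 4) :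
    (quadraticProblem p hp T b).IsMixing τ where
  invariant := invariant_refreshKernel (S := Bool) (π := fairCoin) hp
  unique ν hν h := by
    change Measure Bool at ν
    have : IsProbabilityMeasure ν := hν
    exact eq_of_invariant_refreshKernel hp1 h
  ergodic k := by
    have hmk := isMarkovKernel_refreshKernel (π := fairCoin) (pow_le_one' hp k)
    have h : dobrushin ((quadraticProblem p hp T b).Q ^ k)
        = dobrushin (refreshKernel (p ^ k) fairCoin) := by
      congr 1
      exact refreshKernel_pow hp k
    rw [h]
    refine dobrushin_refreshKernel_le.trans ?_
    -- Dropping the remainder of `k` modulo `τ` only increases the power.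
    have hk : p ^ k ≤ (1 / 4) ^ (k / τ) := calc
      p ^ k ≤ p ^ (τ * (k / τ)) := pow_le_pow_right_of_le_one' hp (Nat.mul_div_le k τ)
      _ = (p ^ τ) ^ (k / τ) := pow_mul _ _ _
      _ ≤ (1 / 4) ^ (k / τ) := by gcongr
    have hcast : ((1 / 4 : ℝ≥0∞)) ^ (k / τ) = (((1 / 4) ^ (k / τ) : ℝ≥0) : ℝ≥0∞) := by
      push_cast [ENNReal.coe_div]
      simp
    rw [hcast]
    exact_mod_cast hk

/-- Only the linear term is random, so the noise is plus or minus half of `b true - b false` at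
every `x`; hence `δ = 0`. -/
theorem quadraticProblem_hasBoundedNoise (hT : T.toLinearMap.IsSymmetric) {σ : ℝ}
    (hb : ‖b true - b false‖ ≤ 2 * σ) :
    (quadraticProblem p hp T b).HasBoundedNoise σ 0 where
  integrable x := Integrable.of_finite (α := Bool) (μ := fairCoin)
  unbiased x := by
    rw [quadraticProblem_gradient_f hT]
    simp only [quadraticProblem_gradF hT]
    refine (integral_fairCoin fun z => T x - b z).trans ?_
    module
  bound z x := by
    rw [quadraticProblem_gradient_f hT, quadraticProblem_gradF hT, zero_pow two_ne_zero, zero_mul,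
      add_zero]
    refine pow_le_pow_left₀ (norm_nonneg _) ?_ 2
    have h2 : ‖(1 / 2 : ℝ) • (b true - b false)‖ ≤ σ := by
      rw [norm_smul]
      norm_num
      linarith
    change Bool at z
    cases z
    · have h : T x - b false - (T x - (1 / 2 : ℝ) • (b false + b true))
          = (1 / 2 : ℝ) • (b true - b false) := by module
      rwa [h]
    · have h : T x - b true - (T x - (1 / 2 : ℝ) • (b false + b true))
          = -((1 / 2 : ℝ) • (b true - b false)) := by module
      rwa [h, norm_neg]

theorem quadraticProblem_isMinOn (hT : T.toLinearMap.IsSymmetric)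
    (hpos : ∀ x, 0 ≤ inner ℝ (T x) x) {xstar : EuclideanSpace ℝ (Fin d)}
    (hx : T xstar = (1 / 2 : ℝ) • (b false + b true)) :
    IsMinOn (quadraticProblem p hp T b).f Set.univ xstar := by
  intro x _
  rw [quadraticProblem_f]
  have h := quadratic_sub_sub hT ((1 / 2 : ℝ) • (b false + b true)) x xstar
  rw [hx, sub_self, inner_zero_left, sub_zero] at h
  have := hpos (x - xstar)
  show quadratic T _ xstar ≤ quadratic T _ x
  linarith

end QuadraticProblem

/-! ### Propagation of subspaces along span methods -/

/-- Vectors generated by a span method stay in an increasing family of subspaces as long as every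
answer at a point of one subspace lies in the next one. -/
theorem span_image_lt_le_of_oracle {E : Type*} [AddCommGroup E] [Module ℝ E] {y g : ℕ → E}
    {V : ℕ → Submodule ℝ E} (hV : Monotone V) {N : ℕ}
    (hy : ∀ k, y k ∈ Submodule.span ℝ (g '' {i | i < k}))
    (hg : ∀ k < N, y k ∈ V k → g k ∈ V (k + 1)) {k : ℕ} (hk : k ≤ N) :
    Submodule.span ℝ (g '' {i | i < k}) ≤ V k := by
  induction k using Nat.strong_induction_on with
  | _ k ih =>
    rw [Submodule.span_le]
    rintro _ ⟨i, hi, rfl⟩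
    have hi : i < k := hi
    exact hV (Nat.succ_le_of_lt hi) (hg i (by lia) (ih i hi (by lia) (hy i)))

/-- The output of a first-order method lies in the subspaces that propagate along the oracle
answers, almost surely on the event where they propagate. -/
theorem Problem.IsFirstOrderMethod.ae_mem {d : ℕ} {I : Problem d} {Ω : Type*} [MeasurableSpace Ω]
    {P : Measure Ω} {Z : ℕ → Ω → I.State} {y x : ℕ → Ω → EuclideanSpace ℝ (Fin d)}
    (h : I.IsFirstOrderMethod P Z 0 y x) {V : ℕ → Submodule ℝ (EuclideanSpace ℝ (Fin d))}
    (hV : Monotone V) (N : ℕ) :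
    ∀ᵐ ω ∂P, (∀ k < N, ∀ u ∈ V k, I.gradF u (Z k ω) ∈ V (k + 1)) → x N ω ∈ V N := by
  filter_upwards [ae_all_iff.2 h.query_mem, h.output_mem N] with ω hq ho hg
  simp only [sub_zero] at hq ho
  exact span_image_lt_le_of_oracle hV hq (fun k hk hk' => hg k hk _ hk') le_rfl ho

/-! ### The tridiagonal Hessian and its geometric minimizer -/

section Path

/-- **Schur test** for symmetric nonnegative matrices with bounded row sums. -/
theorem norm_toEuclideanCLM_le_of_row_sum_le {ι : Type*} [Fintype ι] [DecidableEq ι]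
    {M : Matrix ι ι ℝ} (hM : M.IsHermitian) (h0 : ∀ i j, 0 ≤ M i j) {r : ℝ} (hr : 0 ≤ r)
    (hrow : ∀ i, ∑ j, M i j ≤ r) (x : EuclideanSpace ℝ ι) :
    ‖Matrix.toEuclideanCLM (𝕜 := ℝ) M x‖ ≤ r * ‖x‖ := by
  refine le_of_sq_le_sq ?_ (by positivity)
  rw [mul_pow, EuclideanSpace.real_norm_sq_eq, EuclideanSpace.real_norm_sq_eq,
    Matrix.ofLp_toEuclideanCLM]
  have hsymm (i j : ι) : M i j = M j i := by simpa using (hM.apply i j).symm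
  calc ∑ i, (M.mulVec x.ofLp i) ^ 2
      -- Cauchy–Schwarz with weights `M i j`, using the row sum bound for one factor.
      ≤ ∑ i, r * ∑ j, M i j * x.ofLp j ^ 2 := by
        refine Finset.sum_le_sum fun i _ => ?_
        refine (Finset.sum_sq_le_sum_mul_sum_of_sq_le_mul Finset.univ (f := fun j => M i j)
          (g := fun j => M i j * x.ofLp j ^ 2) (fun j _ => h0 i j)
          (fun j _ => mul_nonneg (h0 i j) (sq_nonneg _)) (fun j _ => le_of_eq (by ring))).trans ?_
        exact mul_le_mul_of_nonneg_right (hrow i)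
          (Finset.sum_nonneg fun j _ => mul_nonneg (h0 i j) (sq_nonneg _))
    _ = r * ∑ j, (∑ i, M j i) * x.ofLp j ^ 2 := by
        rw [← Finset.mul_sum, Finset.sum_comm]
        simp only [Finset.sum_mul, hsymm]
    _ ≤ r * ∑ j, r * x.ofLp j ^ 2 := by
        gcongr with j
        exact hrow j
    _ = r ^ 2 * ∑ j, x.ofLp j ^ 2 := by
        rw [← Finset.mul_sum]; ring

variable {n : ℕ} {q : ℝ}

/-- The adjacency matrix of a path on `n` vertices with weight `q` on a loop at the last vertex. -/
def pathMatrix (n : ℕ) (q : ℝ) : Matrix (Fin n) (Fin n) ℝ := fun i j =>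
  (if (j : ℕ) + 1 = i then 1 else 0) + (if (j : ℕ) = i + 1 then 1 else 0)
    + (if (j : ℕ) = i ∧ (i : ℕ) + 1 = n then q else 0)

theorem pathMatrix_isHermitian : (pathMatrix n q).IsHermitian := by
  ext i j
  simp only [Matrix.conjTranspose_apply, pathMatrix, star_trivial]
  grind

theorem pathMatrix_nonneg (hq : 0 ≤ q) (i j : Fin n) : 0 ≤ pathMatrix n q i j := by
  unfold pathMatrix
  positivity

theorem pathMatrix_eq_zero {i j : Fin n} (h : (j : ℕ) + 1 < i) : pathMatrix n q i j = 0 := by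
  unfold pathMatrix
  grind

theorem sum_pathMatrix_mul (i : Fin n) (g : ℕ → ℝ) :
    ∑ j, pathMatrix n q i j * g j = (if 0 < (i : ℕ) then g (i - 1) else 0)
      + (if (i : ℕ) + 1 = n then q * g i else g (i + 1)) := by
  have hi := i.2
  have h1 : ∑ j ∈ Finset.range n, (if j + 1 = (i : ℕ) then g j else 0)
      = if 0 < (i : ℕ) then g (i - 1) else 0 := by
    split_ifs with h
    · rw [Finset.sum_eq_single_of_mem ((i : ℕ) - 1) (by simp; lia) (by grind)]
      grind
    · exact Finset.sum_eq_zero (by grind)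
  have h2 : ∑ j ∈ Finset.range n, ((if j = (i : ℕ) + 1 then g j else 0)
      + (if j = (i : ℕ) ∧ (i : ℕ) + 1 = n then q * g j else 0))
      = if (i : ℕ) + 1 = n then q * g i else g (i + 1) := by
    split_ifs with h
    · rw [Finset.sum_eq_single_of_mem (i : ℕ) (by simp) (by grind)]
      simp [← h]
    · rw [Finset.sum_eq_single_of_mem ((i : ℕ) + 1) (by simp; lia) (by grind)]
      simp
  rw [← h1, ← h2, ← Finset.sum_add_distrib,
    ← Fin.sum_univ_eq_sum_range (fun j => (if j + 1 = (i : ℕ) then g j else 0)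
      + ((if j = (i : ℕ) + 1 then g j else 0)
      + (if j = (i : ℕ) ∧ (i : ℕ) + 1 = n then q * g j else 0)))]
  refine Finset.sum_congr rfl fun j _ => ?_
  simp only [pathMatrix, add_mul, ite_mul, one_mul, zero_mul, add_assoc]

theorem sum_pathMatrix_le (hq : q ≤ 1) (i : Fin n) : ∑ j, pathMatrix n q i j ≤ 2 := by
  have h := sum_pathMatrix_mul (q := q) i fun _ => 1
  simp only [mul_one] at h
  rw [h]
  split_ifs <;> linarith

/-- The Hessian `μ + (L - μ) / 4 * (2 - J)` with `J` the path matrix. -/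
noncomputable def chainHessian (n : ℕ) (q μ L : ℝ) :
    EuclideanSpace ℝ (Fin n) →L[ℝ] EuclideanSpace ℝ (Fin n) :=
  ((L + μ) / 2) • ContinuousLinearMap.id ℝ _
    - ((L - μ) / 4) • Matrix.toEuclideanCLM (𝕜 := ℝ) (pathMatrix n q)

variable {μ L : ℝ}

theorem chainHessian_apply (x : EuclideanSpace ℝ (Fin n)) :
    chainHessian n q μ L x = ((L + μ) / 2) • x
      - ((L - μ) / 4) • Matrix.toEuclideanCLM (𝕜 := ℝ) (pathMatrix n q) x := rfl

theorem chainHessian_apply_apply (x : EuclideanSpace ℝ (Fin n)) (i : Fin n) :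
    chainHessian n q μ L x i = (L + μ) / 2 * x i
      - (L - μ) / 4 * ∑ j, pathMatrix n q i j * x j := by
  rw [chainHessian_apply]
  simp only [PiLp.sub_apply, PiLp.smul_apply, smul_eq_mul, Matrix.ofLp_toEuclideanCLM]
  rfl

theorem chainHessian_isSymmetric :
    (chainHessian n q μ L : EuclideanSpace ℝ (Fin n) →ₗ[ℝ] _).IsSymmetric := by
  intro x y
  have h : inner ℝ (Matrix.toEuclideanCLM (𝕜 := ℝ) (pathMatrix n q) x) y
      = inner ℝ x (Matrix.toEuclideanCLM (𝕜 := ℝ) (pathMatrix n q) y) :=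
    Matrix.isSymmetric_toEuclideanLin_iff.2 (pathMatrix_isHermitian (n := n) (q := q)) x y
  simp only [ContinuousLinearMap.coe_coe, chainHessian_apply, inner_sub_left, inner_sub_right,
    real_inner_smul_left, real_inner_smul_right, h]

theorem norm_pathMatrix_le (hq0 : 0 ≤ q) (hq1 : q ≤ 1) (x : EuclideanSpace ℝ (Fin n)) :
    ‖Matrix.toEuclideanCLM (𝕜 := ℝ) (pathMatrix n q) x‖ ≤ 2 * ‖x‖ :=
  norm_toEuclideanCLM_le_of_row_sum_le pathMatrix_isHermitian (pathMatrix_nonneg hq0)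
    zero_le_two (sum_pathMatrix_le hq1) x

/-- The path matrix has norm at most `2`, and `(L + μ)/2 + 2 (L - μ)/4 = L`; the minus sign gives
`μ` in the lower bound. -/
theorem norm_chainHessian_le (hq0 : 0 ≤ q) (hq1 : q ≤ 1) (hμ : 0 ≤ μ) (hL : μ ≤ L)
    (x : EuclideanSpace ℝ (Fin n)) : ‖chainHessian n q μ L x‖ ≤ L * ‖x‖ := by
  rw [chainHessian_apply]
  refine (norm_sub_le _ _).trans ?_
  rw [norm_smul_of_nonneg (by linarith), norm_smul_of_nonneg (by linarith)]
  nlinarith [norm_pathMatrix_le hq0 hq1 x]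

theorem le_inner_chainHessian (hq0 : 0 ≤ q) (hq1 : q ≤ 1) (hL : μ ≤ L)
    (x : EuclideanSpace ℝ (Fin n)) : μ * ‖x‖ ^ 2 ≤ inner ℝ (chainHessian n q μ L x) x := by
  have h := real_inner_le_norm (Matrix.toEuclideanCLM (𝕜 := ℝ) (pathMatrix n q) x) x
  have h2 : ‖Matrix.toEuclideanCLM (𝕜 := ℝ) (pathMatrix n q) x‖ * ‖x‖ ≤ 2 * ‖x‖ * ‖x‖ := by
    gcongr
    exact norm_pathMatrix_le hq0 hq1 x
  rw [chainHessian_apply, inner_sub_left, real_inner_smul_left, real_inner_smul_left,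
    real_inner_self_eq_norm_sq]
  nlinarith

/-- The vector with geometric coordinates `1, q, q², …`. -/
noncomputable def geometricVector (n : ℕ) (q : ℝ) : EuclideanSpace ℝ (Fin n) :=
  WithLp.toLp 2 fun i => q ^ (i : ℕ)

/-- The subspace of the vectors supported on the first `k` coordinates. -/
def supportedBelow (n k : ℕ) : Submodule ℝ (EuclideanSpace ℝ (Fin n)) where
  carrier := {v | ∀ i : Fin n, k ≤ i → v i = 0}
  add_mem' ha hb i hi := by simp [ha i hi, hb i hi]
  zero_mem' _ _ := rfl
  smul_mem' c v hv i hi := by simp [hv i hi]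

theorem supportedBelow_mono : Monotone (supportedBelow n) :=
  fun _ _ hkl _ hv i hi => hv i (hkl.trans hi)

theorem chainHessian_mem_supportedBelow {k : ℕ} {x : EuclideanSpace ℝ (Fin n)}
    (hx : x ∈ supportedBelow n k) : chainHessian n q μ L x ∈ supportedBelow n (k + 1) := by
  intro i hi
  rw [chainHessian_apply_apply, hx i (by lia), Finset.sum_eq_zero, mul_zero, mul_zero, sub_zero]
  intro j _
  by_cases hj : k ≤ (j : ℕ)
  · rw [hx j hj, mul_zero]
  · rw [pathMatrix_eq_zero (by lia), zero_mul]

/-- The hypothesis says that `q` solves the three-term recursion of the interior rows. The loop of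
weight `q` supplies the missing neighbour `q ^ n` in the last row, so truncation is exact; only row
`0` leaves a residual. -/
theorem chainHessian_geometricVector_mem (h : 4 * μ * q = (L - μ) * (1 - q) ^ 2) :
    chainHessian n q μ L (geometricVector n q) ∈ supportedBelow n 1 := by
  intro i hi
  obtain ⟨m, hm⟩ : ∃ m, (i : ℕ) = m + 1 := ⟨i - 1, by lia⟩
  rw [chainHessian_apply_apply]
  have hs := sum_pathMatrix_mul (q := q) i fun j => q ^ j
  have hlast : (if (i : ℕ) + 1 = n then q * q ^ (i : ℕ) else q ^ ((i : ℕ) + 1)) = q ^ (m + 2) := by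
    rw [hm]; split_ifs <;> ring
  rw [hlast, if_pos (by lia), hm, Nat.add_sub_cancel] at hs
  simp only [geometricVector, hs, hm]
  linear_combination (q ^ m / 4) * h

theorem pow_le_norm_sub_geometricVector_sq {N : ℕ} (hN : N < n) {v : EuclideanSpace ℝ (Fin n)}
    (hv : v ∈ supportedBelow n N) : (q ^ N) ^ 2 ≤ ‖v - geometricVector n q‖ ^ 2 := by
  have h := PiLp.norm_apply_le (v - geometricVector n q) ⟨N, hN⟩
  rw [PiLp.sub_apply, hv ⟨N, hN⟩ le_rfl, zero_sub, norm_neg, Real.norm_eq_abs] at h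
  rw [← sq_abs (q ^ N)]
  exact pow_le_pow_left₀ (abs_nonneg _) h 2

end Path

/-! ### From error bounds to iteration counts -/

theorem exists_nnreal_pow_eq_one_div_four {τ : ℕ} (hτ : 1 ≤ τ) :
    ∃ p : ℝ≥0, 0 < p ∧ p < 1 ∧ p ^ τ = 1 / 4 := by
  have hτ0 : (0 : ℝ) < τ := by exact_mod_cast hτ
  refine ⟨(1 / 4) ^ (1 / (τ : ℝ)), NNReal.rpow_pos (by norm_num), ?_, ?_⟩
  · exact NNReal.rpow_lt_one (by rw [div_lt_one] <;> norm_num) (by positivity)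
  · rw [← NNReal.rpow_natCast, ← NNReal.rpow_mul, one_div_mul_cancel hτ0.ne', NNReal.rpow_one]

/-- The condition `ε ≤ K ^ 2` lets the constant `K` absorb at most half of `log ε`, leaving `N log p
≤ (log ε)/2`, while `τ log p = -2 log 2`. -/
theorem mul_log_le_of_mul_pow_le {τ N : ℕ} {p K ε : ℝ} (hp : 0 < p) (hpτ : p ^ τ = 1 / 4)
    (hK : 0 < K) (hε : 0 < ε) (hεK : ε ≤ K ^ 2) (h : K * p ^ N ≤ ε) :
    τ * Real.log (1 / ε) ≤ 4 * N := by
  have h1 : Real.log K + N * Real.log p ≤ Real.log ε := by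
    rw [← Real.log_pow, ← Real.log_mul hK.ne' (by positivity)]
    exact Real.log_le_log (by positivity) h
  have h2 : Real.log ε ≤ 2 * Real.log K := by
    have := Real.log_le_log hε hεK
    rwa [Real.log_pow] at this
  have h3 : τ * Real.log p = -(2 * Real.log 2) := by
    rw [← Real.log_pow, hpτ, one_div, Real.log_inv, show (4 : ℝ) = 2 ^ 2 by norm_num,
      Real.log_pow]
    norm_num
  have h4 : (N : ℝ) * Real.log p ≤ Real.log ε / 2 := by linarith
  have h5 : (τ : ℝ) * (N * Real.log p) ≤ τ * (Real.log ε / 2) := by gcongr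
  have h6 : (τ : ℝ) * (N * Real.log p) = N * -(2 * Real.log 2) := by rw [← h3]; ring
  have h7 : (N : ℝ) * Real.log 2 ≤ N * 1 := by
    gcongr
    linarith [Real.log_two_lt_d9]
  rw [one_div, Real.log_inv]
  linarith

theorem mul_log_le_of_pow_le {N : ℕ} {s ε : ℝ} (hs : 2 ≤ s)
    (h : (((s - 1) / (s + 1)) ^ N) ^ 2 ≤ ε) : s * Real.log (1 / ε) ≤ 8 * N := by
  have hq : 0 < (s - 1) / (s + 1) := div_pos (by linarith) (by linarith)
  have h1 : 2 * (N * Real.log ((s - 1) / (s + 1))) ≤ Real.log ε := by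
    have := Real.log_le_log (by positivity) h
    rwa [Real.log_pow, Real.log_pow, Nat.cast_ofNat] at this
  -- From `log t ≤ t - 1` the left side is at most `2/(s - 1)`, and `s ≥ 2` makes this at most
  -- `4/s`.
  have h2 : -Real.log ((s - 1) / (s + 1)) ≤ 4 / s := by
    rw [← Real.log_inv, inv_div]
    refine (Real.log_le_sub_one_of_pos (div_pos (by linarith) (by linarith))).trans ?_
    rw [div_sub_one (by linarith), div_le_div_iff₀ (by linarith) (by linarith)]
    linarith
  have h3 : Real.log (1 / ε) ≤ 2 * (N * (4 / s)) := by
    rw [one_div, Real.log_inv]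
    have : (N : ℝ) * -Real.log ((s - 1) / (s + 1)) ≤ N * (4 / s) := by gcongr
    linarith
  calc s * Real.log (1 / ε) ≤ s * (2 * (N * (4 / s))) := by gcongr
    _ = 8 * N := by field_simp; ring

theorem mul_measureReal_le_of_lintegral_le {Ω : Type*} [MeasurableSpace Ω] {P : Measure Ω}
    [IsFiniteMeasure P] {A : Set Ω} (hA : MeasurableSet A) {g : Ω → ℝ} {K ε : ℝ} (hK : 0 ≤ K)
    (hε : 0 ≤ ε) (hg : ∀ᵐ ω ∂P, ω ∈ A → K ≤ g ω)
    (h : ∫⁻ ω, ENNReal.ofReal (g ω) ∂P ≤ ENNReal.ofReal ε) : K * P.real A ≤ ε := by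
  have h1 : ∫⁻ ω, A.indicator (fun _ => ENNReal.ofReal K) ω ∂P ≤ ENNReal.ofReal ε := by
    refine (lintegral_mono_ae ?_).trans h
    filter_upwards [hg] with ω hω
    by_cases hωA : ω ∈ A
    · simpa [hωA] using ENNReal.ofReal_le_ofReal (hω hωA)
    · simp [hωA]
  rw [lintegral_indicator_const hA] at h1
  have h2 := ENNReal.toReal_mono ENNReal.ofReal_ne_top h1
  rwa [ENNReal.toReal_mul, ENNReal.toReal_ofReal hK, ENNReal.toReal_ofReal hε] at h2

/-! ### The instance for the mixing time -/

section Dormant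

/-- The linear term that vanishes in one of the two states. -/
noncomputable def dormantForce (z : Bool) : EuclideanSpace ℝ (Fin 1) :=
  if z then EuclideanSpace.single 0 1 else 0

/-- The one-dimensional quadratic `μ x² / 2` with a linear term that is switched off in one of the
two states, so that a method which has only met this state has not left the origin. -/
noncomputable def dormantProblem (p : ℝ≥0) (hp : p ≤ 1) (μ : ℝ) : Problem 1 :=
  quadraticProblem p hp (μ • ContinuousLinearMap.id ℝ _) dormantForce

theorem isSymmetric_smul_id {E : Type*} [NormedAddCommGroup E] [InnerProductSpace ℝ E] (μ : ℝ) :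
    (μ • ContinuousLinearMap.id ℝ E).toLinearMap.IsSymmetric := fun x y => by
  simp [real_inner_smul_left, real_inner_smul_right]

variable {p : ℝ≥0} {hp : p ≤ 1} {μ : ℝ}

theorem dormantProblem_lower_bound (hp0 : 0 < p) {τ : ℕ} (hpτ : p ^ τ = 1 / 4) (hμ : 0 < μ)
    {Ω : Type*} [MeasurableSpace Ω] {P : Measure Ω} [IsProbabilityMeasure P]
    {Z : ℕ → Ω → (dormantProblem p hp μ).State}
    (hZ : IsMarkovChain (dormantProblem p hp μ).Q (dormantProblem p hp μ).π Z P)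
    {y x : ℕ → Ω → EuclideanSpace ℝ (Fin 1)}
    (h : (dormantProblem p hp μ).IsFirstOrderMethod P Z 0 y x) {ε : ℝ} (hε : 0 < ε)
    (hεμ : ε ≤ (1 / (8 * μ ^ 2)) ^ 2) {N : ℕ}
    (hN : ∫⁻ ω, ENNReal.ofReal (‖x N ω - EuclideanSpace.single 0 (1 / (2 * μ))‖ ^ 2) ∂P
      ≤ ENNReal.ofReal ε) :
    τ * Real.log (1 / ε) ≤ 4 * N := by
  refine mul_log_le_of_mul_pow_le (p := p) (by exact_mod_cast hp0) (by simpa using congrArg NNReal.toReal hpτ)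
    (by positivity) hε hεμ ?_
  have hA := IsMarkovChain.le_measure_forall_eq (S := Bool) (π := fairCoin) hZ false N
  rw [fairCoin_real_false] at hA
  have hmeas : MeasurableSet {ω | ∀ i ≤ N, Z i ω = false} := by
    simp only [Set.ofPred_forall]
    exact .iInter fun i => .iInter fun _ =>
      hZ.measurable i (measurableSet_singleton (α := Bool) false)
  have hfar : ∀ᵐ ω ∂P, ω ∈ {ω | ∀ i ≤ N, Z i ω = false} →
      1 / (4 * μ ^ 2) ≤ ‖x N ω - EuclideanSpace.single 0 (1 / (2 * μ))‖ ^ 2 := by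
    filter_upwards [h.ae_mem (V := fun _ => ⊥) monotone_const N] with ω hω hωA
    have hx : x N ω = 0 := by
      refine (Submodule.mem_bot ℝ).1 (hω fun k hk u hu => ?_)
      rw [hωA k hk.le, (Submodule.mem_bot ℝ).1 hu]
      refine (Submodule.mem_bot ℝ).2 ?_
      refine (quadraticProblem_gradF (isSymmetric_smul_id μ) 0 false).trans ?_
      simp [dormantForce]
    rw [hx, zero_sub, norm_neg, PiLp.norm_single, Real.norm_eq_abs, sq_abs, div_pow,
      mul_pow]
    norm_num
  have hfin := mul_measureReal_le_of_lintegral_le hmeas (by positivity) hε.le hfar hN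
  calc 1 / (8 * μ ^ 2) * (p : ℝ) ^ N = 1 / (4 * μ ^ 2) * (1 / 2 * (p : ℝ) ^ N) := by
        field_simp; norm_num
    _ ≤ 1 / (4 * μ ^ 2) * P.real {ω | ∀ i ≤ N, Z i ω = false} :=
        mul_le_mul_of_nonneg_left hA (by positivity)
    _ ≤ ε := hfin

end Dormant

/-! ### The instance for the condition number -/

section Chain

/-- The noiseless tridiagonal quadratic with minimizer `1, q, q², …`. -/
noncomputable def chainProblem (p : ℝ≥0) (hp : p ≤ 1) (n : ℕ) (q μ L : ℝ) : Problem n :=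
  quadraticProblem p hp (chainHessian n q μ L)
    fun _ => chainHessian n q μ L (geometricVector n q)

variable {p : ℝ≥0} {hp : p ≤ 1} {n : ℕ} {q μ L : ℝ}

/-- Whatever the state, the answer at `u` is the Hessian at `u` minus a vector supported on the
first coordinate, so supports grow by at most one per call and coordinate `N` of the output is still
zero. -/
theorem chainProblem_lower_bound (h : 4 * μ * q = (L - μ) * (1 - q) ^ 2)
    {Ω : Type*} [MeasurableSpace Ω] {P : Measure Ω} [IsProbabilityMeasure P]
    {Z : ℕ → Ω → (chainProblem p hp n q μ L).State} {y x : ℕ → Ω → EuclideanSpace ℝ (Fin n)}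
    (hm : (chainProblem p hp n q μ L).IsFirstOrderMethod P Z 0 y x) {ε : ℝ} (hε : 0 ≤ ε) {N : ℕ}
    (hNn : N < n) (hN : ∫⁻ ω, ENNReal.ofReal (‖x N ω - geometricVector n q‖ ^ 2) ∂P
      ≤ ENNReal.ofReal ε) : (q ^ N) ^ 2 ≤ ε := by
  have hfar : ∀ᵐ ω ∂P, ω ∈ (Set.univ : Set Ω) →
      (q ^ N) ^ 2 ≤ ‖x N ω - geometricVector n q‖ ^ 2 := by
    filter_upwards [hm.ae_mem supportedBelow_mono N] with ω hω _
    refine pow_le_norm_sub_geometricVector_sq hNn (hω fun k _ u hu => ?_)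
    have hgrad := quadraticProblem_gradF (p := p) (hp := hp)
      (b := fun _ => chainHessian n q μ L (geometricVector n q))
      (chainHessian_isSymmetric (n := n) (q := q) (μ := μ) (L := L)) u (Z k ω)
    refine hgrad ▸ sub_mem (chainHessian_mem_supportedBelow hu)
      (supportedBelow_mono (by lia) (chainHessian_geometricVector_mem h))
  simpa using mul_measureReal_le_of_lintegral_le .univ (by positivity) hε hfar hN

end Chain

end MarkovOpt

/-! ### Choice of the instance and of the constants -/

theorem mainTheorem5 :
    ∃ c : ℝ, 0 < c ∧
    ∀ μ : ℝ, 0 < μ → ∃ ε₀ : ℝ, 0 < ε₀ ∧ ε₀ < 1 ∧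
    ∀ L : ℝ, μ ≤ L → ∀ τ : ℕ, 1 ≤ τ →
    ∀ ε₁ : ℝ, 0 < ε₁ →
    ∃ (d : ℕ) (I : MarkovOpt.Problem d) (xstar : EuclideanSpace ℝ (Fin d)),
      I.OracleWellDefined ∧ I.IsSmooth L ∧ I.IsStronglyConvex μ ∧ I.IsMixing τ ∧
      I.HasBoundedNoise 1 0 ∧ IsMinOn I.f Set.univ xstar ∧
      ∀ (Ω : Type*) [MeasurableSpace Ω] (P : Measure Ω) [IsProbabilityMeasure P]
        (Z : ℕ → Ω → I.State), MarkovOpt.IsMarkovChain I.Q I.π Z P →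
        ∀ y x : ℕ → Ω → EuclideanSpace ℝ (Fin d), I.IsFirstOrderMethod P Z 0 y x →
        ∀ ε : ℝ, ε₁ ≤ ε → ε ≤ ε₀ →
        ∀ N : ℕ, ∫⁻ ω, ENNReal.ofReal (‖x N ω - xstar‖ ^ 2) ∂P ≤ ENNReal.ofReal ε →
          c * ((τ + √(L / μ)) * Real.log (1 / ε)) ≤ N := by
  -- In either case `(τ + √(L/μ)) log(1/ε) ≤ 12 N`, so `1/16` has room to spare. In `ε₀`, the `1/2`
  -- keeps the logarithm nonnegative and the other term is what the dormant instance needs.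
  refine ⟨1 / 16, by norm_num, fun μ hμ => ⟨min (1 / 2) ((1 / (8 * μ ^ 2)) ^ 2),
    by positivity, (min_le_left _ _).trans_lt (by norm_num), fun L hL τ hτ ε₁ hε₁ => ?_⟩⟩
  obtain ⟨p, hp0, hp1, hpτ⟩ := MarkovOpt.exists_nnreal_pow_eq_one_div_four hτ
  have hτ1 : (1 : ℝ) ≤ τ := by exact_mod_cast hτ
  have hlog {ε : ℝ} (h1 : ε₁ ≤ ε) (h2 : ε ≤ min (1 / 2) ((1 / (8 * μ ^ 2)) ^ 2)) :
      0 ≤ Real.log (1 / ε) := by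
    have hε := hε₁.trans_le h1
    refine Real.log_nonneg ((one_le_div hε).2 ?_)
    linarith [h2.trans (min_le_left _ _)]
  -- The factor `2` makes the second case imply `√(L/μ) ≥ 2`, which the logarithmic estimate there
  -- requires.
  rcases le_or_gt (√(L / μ)) (2 * τ) with hs | hs
  · have hsymm := MarkovOpt.isSymmetric_smul_id (E := EuclideanSpace ℝ (Fin 1)) μ
    have hinner (x : EuclideanSpace ℝ (Fin 1)) :
        inner ℝ ((μ • ContinuousLinearMap.id ℝ _ : _ →L[ℝ] _) x) x = μ * ‖x‖ ^ 2 := by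
      simp [real_inner_smul_left]
    refine ⟨1, MarkovOpt.dormantProblem p hp1.le μ, EuclideanSpace.single 0 (1 / (2 * μ)),
      MarkovOpt.quadraticProblem_oracleWellDefined hsymm,
      MarkovOpt.quadraticProblem_isSmooth hsymm fun x => ?_,
      MarkovOpt.quadraticProblem_isStronglyConvex hsymm fun x => (hinner x).ge,
      MarkovOpt.quadraticProblem_isMixing hp1 hpτ.le,
      MarkovOpt.quadraticProblem_hasBoundedNoise hsymm ?_,
      MarkovOpt.quadraticProblem_isMinOn hsymm (fun x => (hinner x).ge.trans' (by positivity)) ?_,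
      fun Ω _ P _ Z hZ y x hm ε hε1 hε0 N hN => ?_⟩
    · simp only [FunLike.coe_smul, Pi.smul_apply, ContinuousLinearMap.id_apply,
        norm_smul_of_nonneg hμ.le]
      gcongr
    · simp [MarkovOpt.dormantForce]
    · ext i
      fin_cases i
      simp [MarkovOpt.dormantForce]
      field_simp
    · have key := MarkovOpt.dormantProblem_lower_bound hp0 hpτ hμ hZ hm (hε₁.trans_le hε1)
        (hε0.trans (min_le_right _ _)) hN
      have := mul_le_mul_of_nonneg_right hs (hlog hε1 hε0)
      linarith [N.cast_nonneg (α := ℝ)]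
  · set s := √(L / μ) with hsdef
    have hs2 : 2 ≤ s := by linarith
    have hLs : L = s ^ 2 * μ := by
      rw [hsdef, Real.sq_sqrt (div_nonneg (hμ.le.trans hL) hμ.le), div_mul_cancel₀ _ hμ.ne']
    set q := (s - 1) / (s + 1) with hq
    have hq0 : 0 ≤ q := div_nonneg (by linarith) (by linarith)
    have hq1 : q ≤ 1 := (div_le_one (by linarith)).2 (by linarith)
    have hrel : 4 * μ * q = (L - μ) * (1 - q) ^ 2 := by
      have : s + 1 ≠ 0 := by linarith
      rw [hLs, hq]
      field_simp
      ring
    -- With this dimension, the claimed bound holds trivially once `N ≥ n`, since `ε ≥ ε₁`.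
    obtain ⟨n, hn⟩ := exists_nat_ge (s * Real.log (1 / ε₁) / 8)
    have hsymm := MarkovOpt.chainHessian_isSymmetric (n := n) (q := q) (μ := μ) (L := L)
    have hinner := MarkovOpt.le_inner_chainHessian (n := n) hq0 hq1 hL
    refine ⟨n, MarkovOpt.chainProblem p hp1.le n q μ L, MarkovOpt.geometricVector n q,
      MarkovOpt.quadraticProblem_oracleWellDefined hsymm,
      MarkovOpt.quadraticProblem_isSmooth hsymm
        (MarkovOpt.norm_chainHessian_le hq0 hq1 hμ.le hL),
      MarkovOpt.quadraticProblem_isStronglyConvex hsymm hinner,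
      MarkovOpt.quadraticProblem_isMixing hp1 hpτ.le,
      MarkovOpt.quadraticProblem_hasBoundedNoise hsymm (by simp),
      MarkovOpt.quadraticProblem_isMinOn hsymm (fun x => (hinner x).trans' (by positivity))
        (by module),
      fun Ω _ P _ Z _ y x hm ε hε1 hε0 N hN => ?_⟩
    have hε := hε₁.trans_le hε1
    have key : s * Real.log (1 / ε) ≤ 8 * N := by
      rcases lt_or_ge N n with hNn | hNn
      · exact MarkovOpt.mul_log_le_of_pow_le hs2
          (MarkovOpt.chainProblem_lower_bound hrel hm hε.le hNn hN)
      · have h1 : s * Real.log (1 / ε) ≤ s * Real.log (1 / ε₁) := by gcongr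
        have h2 : (n : ℝ) ≤ N := by exact_mod_cast hNn
        linarith
    have := mul_le_mul_of_nonneg_right hs.le (hlog hε1 hε0)
    linarith [N.cast_nonneg (α := ℝ)]
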